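/- Let $\Bbbk$ be an algebraically closed field of characteristic $0$, let $\mathcal S=\Bbbk[X_0,\dots,X_n]$ and $\mathcal R=\Bbbk[Y_0,\dots,Y_n]$ with their standard gradings, and let $\mathcal R$ act on $\mathcal S$ by differentiation, $Y^\beta\circ X^\alpha=\frac{\alpha!}{(\alpha-\beta)!}X^{\alpha-\beta}$ if $\alpha\succeq\beta$ and $0$ otherwise. Regard $\mathcal R$ as the coordinate ring of $\mathbb P^n=\mathbb P(\mathcal S_1)$. A $0$-dimensional scheme $Z\subset\mathbb P^n$ with saturated ideal $I(Z)\subseteq\mathcal R$ is *apolar* to $F\in\mathcal S_d$ if $G\circ F=0$ for all $G\in I(Z)$, and *irredundant* to $F$ if it is apolar to $F$ and no strict subscheme of $Z$ is apolar to $F$. Its Hilbert function is $\mathrm{HF}_Z(i)=\dim_\Bbbk \mathcal R_i/I(Z)_i$, which is eventually constant equal to the length $\mathrm{len}(Z)$; its regularity is $\mathrm{reg}(Z)=\min\{i\in\mathbb N:\mathrm{HF}_Z(i)=\mathrm{HF}_Z(i+1)=\mathrm{len}(Z)\}$, and $Z$ is *$d$-regular* if $\mathrm{reg}(Z)\le d$.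 A *generalized additive decomposition* (GAD) of $F\in\mathcal S_d$ is an expression $F=\sum_{i=1}^s L_i^{d-k_i}G_i$ with $L_1,\dots,L_s\in\mathcal S_1$ nonzero and pairwise non-proportional, $0\le k_i\le d$, and $G_i\in\mathcal S_{k_i}$ not divisible by $L_i$. For $F\in\mathcal S_d$ and $0\ne L\in\mathcal S_1$, the *natural apolar scheme* $Z_{F,L}$ is defined as follows. Complete $L=L_0$ to a basis $L_0,\dots,L_n$ of $\mathcal S_1$ and write $F$ in these coordinates in divided powers, $F=\sum_{|\alpha|=d}c_\alpha L_0^{[\alpha_0]}\cdots L_n^{[\alpha_n]}$, where $L_j^{[a]}=L_j^a/a!$. Let $f_L=\sum_{|\alpha|=d}c_\alpha\, x_1^{[\alpha_1]}\cdots x_n^{[\alpha_n]}$, and let $\Bbbk[y_1,\dots,y_n]$ act by contraction: $y^\beta$ sends $x^{[\alpha]}$ to $x^{[\alpha-\beta]}$ if $\alpha\succeq\beta$ and to $0$ otherwise. In the basis of $\mathcal R_1$ dual to $L_0,\dots,L_n$, the ideal $I(Z_{F,L})$ is the homogenization of the annihilator of $f_L$ in $\Bbbk[y_1,\dots,y_n]$;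 the scheme does not depend on the chosen basis. The *scheme evinced by the GAD* $F=\sum_i L_i^{d-k_i}G_i$ is $Z=\bigcup_{i=1}^s Z_{L_i^{d-k_i}G_i,\,L_i}$, that is, $I(Z)=\bigcap_i I(Z_{L_i^{d-k_i}G_i,\,L_i})$. **Proposition.** Let $s>1$, let $L_1,\dots,L_s\in\mathcal S_1$ be $\Bbbk$-linearly independent, and let $Z$ be the scheme evinced by a GAD $F=\sum_{i=1}^s L_i^{d-k_i}G_i$ of $F\in\mathcal S_d$. If either (a) $d>\max_{i\ne j}\{k_i+k_j\}$, or (b) $d>\max_{i\ne j}\{k_i+k_j-2\}$ and $Z$ is irredundant to $F$, then $Z$ is $d$-regular. -/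

import Mathlib

open MvPolynomial

noncomputable section

namespace Apolarity

attribute [local instance] MvPolynomial.gradedAlgebra

/-! ## Differentiation, contraction, divided powers -/

section Actions

variable {k : Type*} [Field k] {σ : Type*} [Fintype σ]

open Classical in
/-- The apolarity action `G ∘ F` of `R = k[Y]` on `S = k[X]` by differentiation: bilinear, with
`Y^β ∘ X^α = α! / (α - β)! X^(α - β)` if `β ≤ α` and `0` otherwise. -/
def diffAction : MvPolynomial σ k →ₗ[k] MvPolynomial σ k →ₗ[k] MvPolynomial σ k :=
  (basisMonomials σ k).constr k fun β =>
    (basisMonomials σ k).constr k fun α =>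
      if β ≤ α then monomial (α - β) ((∏ i, (α i).descFactorial (β i) : ℕ) : k) else 0

/-- The annihilator `Ann(F)` for the apolarity action, as a set. -/
def annSet (F : MvPolynomial σ k) : Set (MvPolynomial σ k) := {G | diffAction G F = 0}

open Classical in
/-- The contraction action of `R` on divided power polynomials. A divided power polynomial
`∑ c_α X^[α]` is stored as the polynomial with coefficients `c_α`; the action is bilinear, with
`Y^β ⌟ X^[α] = X^[α - β]` if `β ≤ α` and `0` otherwise. -/
def contract : MvPolynomial σ k →ₗ[k] MvPolynomial σ k →ₗ[k] MvPolynomial σ k :=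
  (basisMonomials σ k).constr k fun β =>
    (basisMonomials σ k).constr k fun α =>
      if β ≤ α then monomial (α - β) (1 : k) else 0

/-- `F ↦ F_dp`: since `X^α = α! X^[α]`, the coefficient of `X^[α]` in `F_dp` is `α!` times the
coefficient of `X^α` in `F`. -/
def toDividedPowers : MvPolynomial σ k →ₗ[k] MvPolynomial σ k :=
  (basisMonomials σ k).constr k fun α => monomial α ((∏ i, (α i).factorial : ℕ) : k)

end Actions

section Contract

variable {k : Type*} [Field k] {σ : Type*}

open Classical in
theorem contract_monomial (β α : σ →₀ ℕ) (c e : k) :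
    contract (monomial β c) (monomial α e) =
      if β ≤ α then monomial (α - β) (c * e) else 0 := by
  have h1 : monomial β c = c • basisMonomials σ k β := by
    simp [coe_basisMonomials, smul_monomial]
  have h2 : monomial α e = e • basisMonomials σ k α := by
    simp [coe_basisMonomials, smul_monomial]
  have h3 : contract (basisMonomials σ k β) (basisMonomials σ k α) =
      if β ≤ α then monomial (α - β) (1 : k) else 0 := by
    rw [contract, Module.Basis.constr_basis, Module.Basis.constr_basis]
  rw [h1, h2, map_smul, map_smul, LinearMap.smul_apply, h3]
  split_ifs
  · simp [smul_monomial, mul_comm]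
  · simp

theorem contract_mul (g h f : MvPolynomial σ k) :
    contract (g * h) f = contract g (contract h f) := by
  induction g using MvPolynomial.induction_on' with
  | add p q hp hq => simp [add_mul, hp, hq]
  | monomial γ a =>
    induction h using MvPolynomial.induction_on' with
    | add p q hp hq => simp [mul_add, hp, hq]
    | monomial β b =>
      induction f using MvPolynomial.induction_on' with
      | add p q hp hq => rw [map_add, map_add, map_add, hp, hq]
      | monomial α c =>
        rw [monomial_mul, contract_monomial, contract_monomial]
        by_cases h1 : β ≤ α
        · rw [if_pos h1, contract_monomial]
          by_cases h2 : γ ≤ α - β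
          · rw [if_pos h2, if_pos ((le_tsub_iff_right h1).1 h2), tsub_tsub, add_comm β γ, mul_assoc]
          · rw [if_neg h2, if_neg fun h => h2 ((le_tsub_iff_right h1).2 h)]
        · rw [if_neg h1, map_zero, if_neg fun h => h1 (le_trans (by simp) h)]

/-- The annihilator of `f` for the contraction action. -/
def contractAnn (f : MvPolynomial σ k) : Ideal (MvPolynomial σ k) where
  carrier := {g | contract g f = 0}
  zero_mem' := by simp
  add_mem' := by
    intro a b ha hb
    change contract (a + b) f = 0
    change contract a f = 0 at ha
    change contract b f = 0 at hb
    rw [map_add, LinearMap.add_apply, ha, hb, add_zero]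
  smul_mem' := by
    intro c x hx
    change contract (c • x) f = 0
    change contract x f = 0 at hx
    rw [smul_eq_mul, contract_mul, hx, map_zero]

theorem mem_contractAnn {f g : MvPolynomial σ k} : g ∈ contractAnn f ↔ contract g f = 0 := Iff.rfl

/-- The space `R ⌟ f` is finite dimensional. -/
theorem finite_range_contract (f : MvPolynomial σ k) :
    Module.Finite k (LinearMap.range (contract.flip f)) := by
  classical
  let s : Set (σ →₀ ℕ) := ⋃ α ∈ f.support, Set.Iic α
  have hs : s.Finite := f.support.finite_toSet.biUnion fun α _ => Set.finite_Iic α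
  have hle : LinearMap.range (contract.flip f) ≤
      Submodule.span k ((fun β => contract (monomial β (1 : k)) f) '' s) := by
    rintro _ ⟨g, rfl⟩
    rw [LinearMap.flip_apply]
    induction g using MvPolynomial.induction_on' with
    | add p q hp hq => rw [map_add]; exact add_mem hp hq
    | monomial β c =>
      by_cases hβ : β ∈ s
      · have : monomial β c = c • monomial β (1 : k) := by simp [smul_monomial]
        rw [this, map_smul]
        exact Submodule.smul_mem _ _ (Submodule.subset_span ⟨β, hβ, rfl⟩)
      · have : contract (monomial β c) f = 0 := by
          conv_lhs => rw [f.as_sum, map_sum]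
          refine Finset.sum_eq_zero fun α hα => ?_
          rw [contract_monomial, if_neg]
          intro h
          exact hβ (Set.mem_biUnion (Finset.mem_coe.2 hα) h)
        rw [this]
        exact zero_mem _
  have := FiniteDimensional.span_of_finite k (hs.image fun β => contract (monomial β (1 : k)) f)
  exact Submodule.finiteDimensional_of_le hle

end Contract

/-! ## Zero-dimensional subschemes of projective space -/

section Schemes

variable {k : Type*} [Field k] {n : ℕ}

/-- The subspace `I_i = I ∩ R_i` of `R_i`. -/
def gradedPiece (I : Ideal (MvPolynomial (Fin (n + 1)) k)) (i : ℕ) :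
    Submodule k (homogeneousSubmodule (Fin (n + 1)) k i) :=
  (I.restrictScalars k).comap (homogeneousSubmodule (Fin (n + 1)) k i).subtype

/-- The Hilbert function `i ↦ dim R_i / I_i`. -/
def hilbertFunction (I : Ideal (MvPolynomial (Fin (n + 1)) k)) (i : ℕ) : ℕ :=
  Module.finrank k (homogeneousSubmodule (Fin (n + 1)) k i ⧸ gradedPiece I i)

instance finite_homogeneousSubmodule (i : ℕ) :
    Module.Finite k (homogeneousSubmodule (Fin (n + 1)) k i) := by
  exact Module.Finite.iff_fg.2 (homogeneousSubmodule_fg _ _ i)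

theorem finrank_quotient_iInf_le {V : Type*} [AddCommGroup V] [Module k V] [Module.Finite k V]
    {s : ℕ} (W : Fin s → Submodule k V) :
    Module.finrank k (V ⧸ ⨅ i, W i) ≤ ∑ i, Module.finrank k (V ⧸ W i) := by
  let φ : V →ₗ[k] ((i : Fin s) → V ⧸ W i) := LinearMap.pi fun i => (W i).mkQ
  have h2 : LinearMap.ker φ = ⨅ i, W i := by
    rw [LinearMap.ker_pi]
    exact iInf_congr fun i => Submodule.ker_mkQ _
  rw [← h2, LinearEquiv.finrank_eq φ.quotKerEquivRange, ← Module.finrank_pi_fintype k]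
  exact Submodule.finrank_le _

theorem hilbertFunction_iInf_le {s : ℕ} (I : Fin s → Ideal (MvPolynomial (Fin (n + 1)) k))
    (e : ℕ) : hilbertFunction (⨅ i, I i) e ≤ ∑ i, hilbertFunction (I i) e := by
  have h : gradedPiece (⨅ i, I i) e = ⨅ i, gradedPiece (I i) e := by
    ext x
    simp [gradedPiece]
  unfold hilbertFunction
  rw [h]
  exact finrank_quotient_iInf_le _

/-- A closed subscheme `Z` of dimension at most `0` of `ℙⁿ`, given by its ideal `I(Z)` in
`R = k[Y_0, …, Y_n]`: closed subschemes correspond to homogeneous ideals that are saturated with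
respect to the irrelevant ideal, and the dimension is at most `0` exactly when the Hilbert function
is bounded. -/
structure ZeroDimScheme (k : Type*) [Field k] (n : ℕ) where
  /-- The ideal `I(Z)`. -/
  ideal : Ideal (MvPolynomial (Fin (n + 1)) k)
  homogeneous : ideal.IsHomogeneous (homogeneousSubmodule (Fin (n + 1)) k)
  saturated : ∀ p : MvPolynomial (Fin (n + 1)) k,
    (∃ m : ℕ, ∀ q : MvPolynomial (Fin (n + 1)) k, q.IsHomogeneous m → q * p ∈ ideal) → p ∈ ideal
  zeroDim : ∃ N : ℕ, ∀ i : ℕ, hilbertFunction ideal i ≤ N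

namespace ZeroDimScheme

/-- `Z'` is a strict subscheme of `Z`. -/
def IsStrictSubscheme (Z' Z : ZeroDimScheme k n) : Prop := Z.ideal < Z'.ideal

/-- `Z` has length `l`: its Hilbert polynomial is the constant `l`. -/
def HasLength (Z : ZeroDimScheme k n) (l : ℕ) : Prop :=
  ∀ᶠ i in Filter.atTop, hilbertFunction Z.ideal i = l

/-- `reg(Z) = min {i : HF_Z(i) = HF_Z(i + 1) = len(Z)}`, with the value `⊤` for an empty set. -/
def regularity (Z : ZeroDimScheme k n) : ℕ∞ :=
  sInf ((fun i : ℕ => (i : ℕ∞)) '' {i : ℕ | Z.HasLength (hilbertFunction Z.ideal i) ∧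
    Z.HasLength (hilbertFunction Z.ideal (i + 1))})

/-- `Z` is `d`-regular. -/
def IsRegular (Z : ZeroDimScheme k n) (d : ℕ) : Prop := Z.regularity ≤ d

/-- `Z` is apolar to `F`: `I(Z) ⊆ Ann(F)`. -/
def IsApolar (Z : ZeroDimScheme k n) (F : MvPolynomial (Fin (n + 1)) k) : Prop :=
  (Z.ideal : Set (MvPolynomial (Fin (n + 1)) k)) ⊆ annSet F

/-- `Z` is irredundant to `F`: it is apolar to `F`, and no strict subscheme of it is. -/
def IsIrredundant (Z : ZeroDimScheme k n) (F : MvPolynomial (Fin (n + 1)) k) : Prop :=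
  Z.IsApolar F ∧ ¬ ∃ Z' : ZeroDimScheme k n, Z'.IsStrictSubscheme Z ∧ Z'.IsApolar F

/-- The union of finitely many schemes, defined by the intersection of the ideals. -/
def union {s : ℕ} (Z : Fin s → ZeroDimScheme k n) : ZeroDimScheme k n where
  ideal := ⨅ i, (Z i).ideal
  homogeneous := Ideal.IsHomogeneous.iInf fun i => (Z i).homogeneous
  saturated := by
    rintro p ⟨m, hm⟩
    refine (Ideal.mem_iInf).2 fun i => (Z i).saturated p ⟨m, fun q hq => ?_⟩
    exact (Ideal.mem_iInf).1 (hm q hq) i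
  zeroDim := by
    choose N hN using fun i => (Z i).zeroDim
    exact ⟨∑ i, N i, fun e => (hilbertFunction_iInf_le _ e).trans
      (Finset.sum_le_sum fun i _ => hN i e)⟩

end ZeroDimScheme

end Schemes

/-! ## Natural apolar schemes -/

section NaturalApolar

variable {k : Type*} [Field k] {n : ℕ}

/-- A basis `L_0, …, L_n` of the space `S_1` of linear forms. -/
abbrev LinearCoords (k : Type*) [Field k] (n : ℕ) : Type _ :=
  Module.Basis (Fin (n + 1)) k (homogeneousSubmodule (Fin (n + 1)) k 1)

/-- The variable `X_m` as an element of `S_1`. -/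
def linX (m : Fin (n + 1)) : homogeneousSubmodule (Fin (n + 1)) k 1 := ⟨X m, isHomogeneous_X k m⟩

/-- The change of coordinates `φ` of `S` with `φ(L_j) = X_j`. -/
def changeS (b : LinearCoords k n) :
    MvPolynomial (Fin (n + 1)) k →ₐ[k] MvPolynomial (Fin (n + 1)) k :=
  aeval fun m => ∑ j, b.repr (linX m) j • X j

/-- The dual change of coordinates `ψ⁻¹` of `R`, where `ψ(Y_j)` is the basis of `R_1` dual to
`L_0, …, L_n`; so `ψ⁻¹(Y_m) = ∑_j (Y_m ∘ L_j) Y_j`. -/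
def changeR (b : LinearCoords k n) :
    MvPolynomial (Fin (n + 1)) k →ₐ[k] MvPolynomial (Fin (n + 1)) k :=
  aeval fun m => ∑ j, coeff (Finsupp.single m 1) (b j : MvPolynomial (Fin (n + 1)) k) • X j

/-- Dehomogenization: `G ↦ G(1, y_1, …, y_n)`. Applied to a stored divided power polynomial it
sends `X_0^[a] X'^[α]` to `x^[α]`. -/
def dehomogenize : MvPolynomial (Fin (n + 1)) k →ₐ[k] MvPolynomial (Fin n) k :=
  aeval (Fin.cons 1 X)

/-- The local generator `f_L = (φ F)_dp(1, x_1, …, x_n)`, where `L = L_0`. -/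
def localGenerator (b : LinearCoords k n) (F : MvPolynomial (Fin (n + 1)) k) :
    MvPolynomial (Fin n) k :=
  dehomogenize (toDividedPowers (changeS b F))

/-- The projection `R → k[y_1, …, y_n]` to the affine chart around `[L]`, in the coordinates `b`. -/
def chart (b : LinearCoords k n) : MvPolynomial (Fin (n + 1)) k →ₐ[k] MvPolynomial (Fin n) k :=
  dehomogenize.comp (changeR b)

/-- The homogenization, brought back to the original coordinates, of an ideal `J` of the affine
chart: the ideal of `R` generated by the homogeneous `G` whose dehomogenization lies in `J`. -/
def homogenizeIdeal (b : LinearCoords k n) (J : Ideal (MvPolynomial (Fin n) k)) :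
    Ideal (MvPolynomial (Fin (n + 1)) k) :=
  ((J.comap (chart b)).homogeneousCore (homogeneousSubmodule (Fin (n + 1)) k)).toIdeal

theorem eq_sum_linX (p : homogeneousSubmodule (Fin (n + 1)) k 1) :
    p = ∑ m, coeff (Finsupp.single m 1) (p : MvPolynomial (Fin (n + 1)) k) • linX m := by
  classical
  have hlin : ∀ m β, coeff β ((linX m : homogeneousSubmodule (Fin (n + 1)) k 1) :
      MvPolynomial (Fin (n + 1)) k) = if Finsupp.single m 1 = β then 1 else 0 := fun m β =>
    coeff_X m β
  apply Subtype.ext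
  ext β
  rw [Submodule.coe_sum, coeff_sum]
  simp only [Submodule.coe_smul, coeff_smul, hlin, smul_eq_mul, mul_ite, mul_one, mul_zero]
  by_cases hβ : β.degree = 1
  · obtain ⟨m, rfl⟩ := (Finsupp.sum_eq_one_iff β).1 hβ
    simp [Finsupp.single_left_inj]
  · rw [IsHomogeneous.coeff_eq_zero p.2 hβ, Finset.sum_eq_zero]
    intro m _
    rw [if_neg]
    rintro rfl
    simp at hβ

/-- A linear form that dehomogenizes to `1`. -/
theorem exists_chart_eq_one (b : LinearCoords k n) :
    ∃ T : MvPolynomial (Fin (n + 1)) k, T.IsHomogeneous 1 ∧ chart b T = 1 := by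
  refine ⟨∑ m, b.repr (linX m) 0 • X m, ?_, ?_⟩
  · refine Submodule.sum_mem (homogeneousSubmodule (Fin (n + 1)) k 1) fun m _ => ?_
    exact Submodule.smul_mem _ _ (isHomogeneous_X k m)
  · have key : ∀ j, ∑ m, b.repr (linX m) 0 *
        coeff (Finsupp.single m 1) (b j : MvPolynomial (Fin (n + 1)) k) = if j = 0 then 1 else 0 := by
      intro j
      have h := congrArg (fun p => b.repr p 0) (eq_sum_linX (b j))
      simp only [Module.Basis.repr_self, map_sum, map_smul, Finsupp.coe_finsetSum,
        Finset.sum_apply, Finsupp.smul_apply, smul_eq_mul, Finsupp.single_apply] at h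
      rw [h]
      exact Finset.sum_congr rfl fun m _ => mul_comm _ _
    have hc : changeR b (∑ m, b.repr (linX m) 0 • X m) = X 0 := by
      simp only [changeR, map_sum, map_smul, aeval_X, Finset.smul_sum, smul_smul]
      rw [Finset.sum_comm]
      simp only [← Finset.sum_smul, key]
      simp
    rw [chart, AlgHom.comp_apply, hc]
    simp [dehomogenize]

theorem mem_homogenizeIdeal_of_isHomogeneous (b : LinearCoords k n)
    (J : Ideal (MvPolynomial (Fin n) k)) {G : MvPolynomial (Fin (n + 1)) k} {e : ℕ}
    (hG : G.IsHomogeneous e) : G ∈ homogenizeIdeal b J ↔ chart b G ∈ J :=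
  ⟨fun h => Ideal.toIdeal_homogeneousCore_le _ (J.comap (chart b)) h, fun h =>
    Ideal.mem_homogeneousCore_of_homogeneous_of_mem ⟨e, hG⟩ h⟩

/-- The natural apolar scheme `Z_{F,L}`, computed in coordinates `L_0 = L, L_1, …, L_n`. -/
def naturalApolar (b : LinearCoords k n) (F : MvPolynomial (Fin (n + 1)) k) :
    ZeroDimScheme k n where
  ideal := homogenizeIdeal b (contractAnn (localGenerator b F))
  homogeneous := HomogeneousIdeal.isHomogeneous _
  saturated := by
    rintro p ⟨m, hm⟩
    obtain ⟨T, hT, hT1⟩ := exists_chart_eq_one b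
    have hhom : (homogenizeIdeal b (contractAnn (localGenerator b F))).IsHomogeneous
        (homogeneousSubmodule (Fin (n + 1)) k) := HomogeneousIdeal.isHomogeneous _
    have hTm : (T ^ m).IsHomogeneous m := by simpa using hT.pow m
    have h := hm (T ^ m) hTm
    refine (hhom.mem_iff _).2 fun e => ?_
    have he := (hhom.mem_iff _).1 h (m + e)
    rw [DirectSum.coe_decompose_mul_add_of_left_mem _ hTm] at he
    have hpe : (DirectSum.decompose (homogeneousSubmodule (Fin (n + 1)) k) p e :
        MvPolynomial (Fin (n + 1)) k).IsHomogeneous e :=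
      (DirectSum.decompose (homogeneousSubmodule (Fin (n + 1)) k) p e).2
    rw [mem_homogenizeIdeal_of_isHomogeneous b _ (hTm.mul hpe)] at he
    rw [mem_homogenizeIdeal_of_isHomogeneous b _ hpe]
    simpa [hT1] using he
  zeroDim := by
    have := finite_range_contract (localGenerator b F)
    refine ⟨Module.finrank k (LinearMap.range (contract.flip (localGenerator b F))), fun e => ?_⟩
    let φ : homogeneousSubmodule (Fin (n + 1)) k e →ₗ[k] MvPolynomial (Fin n) k :=
      contract.flip (localGenerator b F) ∘ₗ (chart b).toLinearMap ∘ₗ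
        (homogeneousSubmodule (Fin (n + 1)) k e).subtype
    have hφ : LinearMap.ker φ =
        gradedPiece (homogenizeIdeal b (contractAnn (localGenerator b F))) e := by
      ext x
      exact (mem_homogenizeIdeal_of_isHomogeneous b
        (contractAnn (localGenerator b F)) x.2).symm
    unfold hilbertFunction
    rw [← hφ]
    refine (LinearEquiv.finrank_eq φ.quotKerEquivRange).trans_le ?_
    exact Submodule.finrank_mono (LinearMap.range_comp_le_range _ _)

/-- `Z` is the natural apolar scheme to `F` supported at `L`. The coordinates `b` that complete `L`
to a basis of `S_1` may be chosen arbitrarily. -/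
def IsNaturalApolar (Z : ZeroDimScheme k n) (F L : MvPolynomial (Fin (n + 1)) k) : Prop :=
  ∃ b : LinearCoords k n, (b 0 : MvPolynomial (Fin (n + 1)) k) = L ∧ Z = naturalApolar b F

end NaturalApolar

/-! ## Generalized additive decompositions -/

section GAD

variable {k : Type*} [Field k] {n : ℕ}

/-- A generalized additive decomposition `F = ∑ L_i^(d - k_i) G_i` of a form `F` of degree `d`. -/
structure GAD (F : MvPolynomial (Fin (n + 1)) k) (d s : ℕ) where
  /-- The linear forms `L_i`. -/
  L : Fin s → MvPolynomial (Fin (n + 1)) k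
  /-- The degrees `k_i`. -/
  deg : Fin s → ℕ
  /-- The forms `G_i`. -/
  G : Fin s → MvPolynomial (Fin (n + 1)) k
  L_isHomogeneous : ∀ i, (L i).IsHomogeneous 1
  L_ne_zero : ∀ i, L i ≠ 0
  not_proportional : ∀ i j, i ≠ j → LinearIndependent k ![L i, L j]
  deg_le : ∀ i, deg i ≤ d
  G_isHomogeneous : ∀ i, (G i).IsHomogeneous (deg i)
  not_dvd : ∀ i, ¬ L i ∣ G i
  eq_sum : F = ∑ i, L i ^ (d - deg i) * G i

/-- `Z` is the scheme evinced by the decomposition: the union of the natural apolar schemes to the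
summands `L_i^(d - k_i) G_i`, supported at the `L_i`. -/
def GAD.Evinces {F : MvPolynomial (Fin (n + 1)) k} {d s : ℕ} (D : GAD F d s)
    (Z : ZeroDimScheme k n) : Prop :=
  ∃ W : Fin s → ZeroDimScheme k n,
    (∀ i, IsNaturalApolar (W i) (D.L i ^ (d - D.deg i) * D.G i) (D.L i)) ∧
      Z = ZeroDimScheme.union W

end GAD

end Apolarity

end

/-! Let f_i be the local generator of the i-th summand. It has degree at most k_i, because the power
of L_i dehomogenizes away. A form of degree e lies in I(Z) exactly when its expression in the chart
at each L_i kills f_i, so R_e / I(Z)_e embeds in ∏ k[y] ⌟ f_i through `evaluation`. If this map is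
onto in degree d, it is onto in every higher degree, since some linear form vanishes at none of the
points [L_i]. The Hilbert function is then constant from d on.

Independence of the L_i gives linear forms T_i with T_i(L_j) = δ_ij. A power T_i^a acts invertibly
on k[y] ⌟ f_i and lowers degrees by a at every other L_j. Multiples of such powers realize any tuple
of local values modulo terms of degree less than r (`exists_isHomogeneous_approx`). Under (a) one
can take r = 0, which is surjectivity.

Under (b) one can take r = 1, so modulo the image every tuple is a tuple of constants. If the image
were proper, a functional (w_i) ↦ ∑ (u_i ⌟ w_i)(0) vanishing on it would be nonzero on some tuple of
constants, so u_i(0) ≠ 0 for some i with f_i ≠ 0. The pairing of G ∈ R_d with F is ∑ (G ⌟ f_i)(0),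
and subtracting a multiple of the functional does not change it. Replacing each f_i by f_i - c u_i ⌟
f_i thus keeps apolarity and, for suitable c, shrinks the scheme
(`exists_strictSubscheme_isApolar`), against irredundancy. -/

namespace Apolarity

attribute [local instance] MvPolynomial.gradedAlgebra

/-! ### Contraction: degree filtration, local units, duality -/

section Contraction

variable {k : Type*} [Field k] {σ : Type*}

theorem coeff_contract_monomial (β γ : σ →₀ ℕ) (c : k) (f : MvPolynomial σ k) :
    coeff γ (contract (monomial β c) f) = c * coeff (γ + β) f := by
  classical
  induction f using MvPolynomial.induction_on' with
  | add p q hp hq => rw [map_add, coeff_add, hp, hq, coeff_add, mul_add]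
  | monomial α e =>
    rw [contract_monomial, coeff_monomial]
    by_cases h : β ≤ α
    · rw [if_pos h, coeff_monomial]
      have : α - β = γ ↔ α = γ + β := tsub_eq_iff_eq_add_of_le h
      simp [this]
    · rw [if_neg h, if_neg, coeff_zero, mul_zero]
      rintro rfl
      exact h (by simp)

theorem constantCoeff_contract_monomial (β : σ →₀ ℕ) (f : MvPolynomial σ k) :
    constantCoeff (contract (monomial β 1) f) = coeff β f := by
  rw [constantCoeff_eq, coeff_contract_monomial, zero_add, one_mul]

theorem eq_zero_of_constantCoeff_contract {f : MvPolynomial σ k}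
    (h : ∀ g, constantCoeff (contract g f) = 0) : f = 0 := by
  ext α
  rw [← constantCoeff_contract_monomial, h, coeff_zero]

theorem contract_one (f : MvPolynomial σ k) : contract 1 f = f := by
  ext γ
  rw [← C_1, C_apply, coeff_contract_monomial, add_zero, one_mul]

theorem contract_C (g : MvPolynomial σ k) (c : k) : contract g (C c) = C (constantCoeff g * c) := by
  classical
  induction g using MvPolynomial.induction_on' with
  | add p q hp hq => rw [map_add, LinearMap.add_apply, hp, hq, map_add, add_mul, C_add]
  | monomial β e =>
    rw [C_apply, contract_monomial, constantCoeff_monomial, C_apply]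
    by_cases h : β = 0
    · simp [h]
    · simp [h]

variable (k σ) in
/-- The polynomials all of whose monomials have degree less than `m`. -/
def degreeLT (m : ℕ) : Submodule k (MvPolynomial σ k) where
  carrier := {p | ∀ α : σ →₀ ℕ, m ≤ α.degree → coeff α p = 0}
  zero_mem' := by simp
  add_mem' := by
    intro p q hp hq α hα
    rw [coeff_add, hp α hα, hq α hα, add_zero]
  smul_mem' := by
    intro c p hp α hα
    rw [coeff_smul, hp α hα, smul_zero]

theorem monomial_mem_degreeLT {m : ℕ} {α : σ →₀ ℕ} (h : α.degree < m) (c : k) :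
    monomial α c ∈ degreeLT k σ m := by
  classical
  intro β hβ
  rw [coeff_monomial, if_neg]
  rintro rfl
  omega

theorem eq_zero_of_mem_degreeLT_zero {p : MvPolynomial σ k} (h : p ∈ degreeLT k σ 0) : p = 0 := by
  ext α
  exact h α (Nat.zero_le _)

theorem eq_C_of_mem_degreeLT_one {p : MvPolynomial σ k} (h : p ∈ degreeLT k σ 1) :
    p = C (constantCoeff p) := by
  classical
  ext α
  rw [coeff_C, constantCoeff_eq]
  split_ifs with h0
  · rw [h0]
  · refine h α (Nat.one_le_iff_ne_zero.2 fun h1 => h0 ?_)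
    exact ((Finsupp.degree_eq_zero_iff α).1 h1).symm

theorem degreeLT_mono {m m' : ℕ} (h : m ≤ m') : degreeLT k σ m ≤ degreeLT k σ m' :=
  fun _ hp α hα => hp α (h.trans hα)

theorem exists_mem_degreeLT (p : MvPolynomial σ k) : ∃ m, p ∈ degreeLT k σ m := by
  refine ⟨p.totalDegree + 1, fun α hα => coeff_eq_zero_of_totalDegree_lt ?_⟩
  exact hα

theorem contract_monomial_mem_degreeLT {m r : ℕ} {p : MvPolynomial σ k}
    (hp : p ∈ degreeLT k σ (m + r)) {β : σ →₀ ℕ} (hβ : m ≤ β.degree) (c : k) :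
    contract (monomial β c) p ∈ degreeLT k σ r := by
  intro γ hγ
  rw [coeff_contract_monomial, hp, mul_zero]
  rw [map_add]
  omega

theorem contract_mem_degreeLT (g : MvPolynomial σ k) {m : ℕ} {p : MvPolynomial σ k}
    (hp : p ∈ degreeLT k σ m) : contract g p ∈ degreeLT k σ m := by
  induction g using MvPolynomial.induction_on' with
  | add a b ha hb => rw [map_add]; exact add_mem ha hb
  | monomial β c =>
    exact contract_monomial_mem_degreeLT (m := 0) (by rwa [zero_add]) (Nat.zero_le _) c

theorem contract_mem_degreeLT_of_constantCoeff_eq_zero {g : MvPolynomial σ k}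
    (hg : constantCoeff g = 0) {m : ℕ} {p : MvPolynomial σ k} (hp : p ∈ degreeLT k σ (m + 1)) :
    contract g p ∈ degreeLT k σ m := by
  rw [g.as_sum, map_sum, LinearMap.sum_apply]
  refine sum_mem fun β hβ => ?_
  refine contract_monomial_mem_degreeLT (m := 1) (by rwa [add_comm]) ?_ _
  refine Nat.one_le_iff_ne_zero.2 fun h0 => ?_
  rw [(Finsupp.degree_eq_zero_iff β).1 h0, mem_support_iff, ← constantCoeff_eq] at hβ
  exact hβ hg

theorem contract_pow_mem_degreeLT {g : MvPolynomial σ k} (hg : constantCoeff g = 0) {r : ℕ}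
    {p : MvPolynomial σ k} (m : ℕ) (hp : p ∈ degreeLT k σ (m + r)) :
    contract (g ^ m) p ∈ degreeLT k σ r := by
  induction m generalizing p with
  | zero => rwa [pow_zero, contract_one, ← zero_add r]
  | succ m ih =>
    rw [pow_succ, contract_mul]
    refine ih (contract_mem_degreeLT_of_constantCoeff_eq_zero hg ?_)
    convert hp using 2
    omega

/-- A polynomial with nonzero constant coefficient acts invertibly. -/
theorem exists_contract_mul_eq {t : MvPolynomial σ k} (ht : constantCoeff t = 1)
    (f : MvPolynomial σ k) : ∃ v : MvPolynomial σ k, ∀ g, contract (t * v * g) f = contract g f := by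
  obtain ⟨N, hN⟩ := exists_mem_degreeLT f
  -- Since 1 - t has no constant term it is nilpotent on k[y] ⌟ f, and a truncated geometric series
  -- inverts t there.
  have h0 : contract ((1 - t) ^ N) f = 0 :=
    eq_zero_of_mem_degreeLT_zero (contract_pow_mem_degreeLT (by simp [ht]) N hN)
  refine ⟨∑ i ∈ Finset.range N, (1 - t) ^ i, fun g => ?_⟩
  have h1 : t * ∑ i ∈ Finset.range N, (1 - t) ^ i = 1 - (1 - t) ^ N := by
    have := mul_neg_geom_sum (1 - t) N
    rwa [sub_sub_cancel] at this
  rw [h1, mul_comm, contract_mul, map_sub, LinearMap.sub_apply, h0, contract_one, sub_zero]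

theorem exists_contract_pow_mul_eq {t : MvPolynomial σ k} (ht : constantCoeff t = 1)
    (f : MvPolynomial σ k) (m : ℕ) (g : MvPolynomial σ k) :
    ∃ v : MvPolynomial σ k, contract (t ^ m * v) f = contract g f := by
  obtain ⟨v, hv⟩ := exists_contract_mul_eq ht f
  induction m with
  | zero => exact ⟨g, by rw [pow_zero, one_mul]⟩
  | succ m ih =>
    obtain ⟨w, hw⟩ := ih
    refine ⟨v * w, ?_⟩
    rw [← hw, ← hv (t ^ m * w)]
    congr 2
    ring

/-- Every functional on a finite dimensional space of divided power polynomials is given by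
contraction followed by evaluation at the origin. -/
theorem exists_functional_eq (A : Submodule k (MvPolynomial σ k)) [Module.Finite k A]
    (lam : Module.Dual k A) :
    ∃ u : MvPolynomial σ k, ∀ w : A, lam w = constantCoeff (contract u (w : MvPolynomial σ k)) := by
  let θ : MvPolynomial σ k →ₗ[k] Module.Dual k A :=
    { toFun := fun u => (lcoeff k (0 : σ →₀ ℕ)) ∘ₗ contract u ∘ₗ A.subtype
      map_add' := by intro u v; ext w; simp
      map_smul' := by intro c u; ext w; simp }
  suffices h : LinearMap.range θ = ⊤ by
    obtain ⟨u, hu⟩ := LinearMap.range_eq_top.1 h lam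
    exact ⟨u, fun w => by rw [← hu]; rfl⟩
  by_contra h
  -- A nonzero functional on the dual of A that vanishes on the range of θ is evaluation at some w,
  -- by finite dimension; all contractions of w vanish at the origin, so w = 0.
  obtain ⟨φ, hφ, hle⟩ := Submodule.exists_le_ker_of_lt_top _ (lt_top_iff_ne_top.2 h)
  obtain ⟨w, rfl⟩ := (Module.evalEquiv k A).surjective φ
  refine hφ ?_
  have hw : w = 0 := Subtype.ext <| eq_zero_of_constantCoeff_contract fun g =>
    LinearMap.mem_ker.1 (hle ⟨g, rfl⟩)
  rw [hw, map_zero]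

/-- A form `g` of degree `e` kills a form `f` of degree `d` as soon as the multiples of `g` of
degree `d` do. -/
theorem contract_eq_zero_of_multiples {g f : MvPolynomial σ k} {e d : ℕ} (hg : g.IsHomogeneous e)
    (hf : f.IsHomogeneous d)
    (h : ∀ q : MvPolynomial σ k, ∀ p, p + e = d → q.IsHomogeneous p →
      constantCoeff (contract (q * g) f) = 0) : contract g f = 0 := by
  refine eq_zero_of_constantCoeff_contract fun q => ?_
  have key : ∀ (β : σ →₀ ℕ) (c : k), constantCoeff (contract (monomial β c * g) f) = 0 := by
    intro β c
    by_cases hβ : β.degree + e = d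
    · exact h _ _ hβ (isHomogeneous_monomial c rfl)
    -- Forms of different degrees pair to zero.
    · have hq : (monomial β c * g).IsHomogeneous (β.degree + e) :=
        (isHomogeneous_monomial c rfl).mul hg
      rw [(monomial β c * g).as_sum, map_sum, LinearMap.sum_apply, map_sum]
      refine Finset.sum_eq_zero fun γ hγ => ?_
      rw [constantCoeff_eq, coeff_contract_monomial, zero_add, hf.coeff_eq_zero, mul_zero]
      intro hd
      apply hβ
      rw [← hd]
      by_contra hne
      exact mem_support_iff.1 hγ (hq.coeff_eq_zero (Ne.symm hne))
  rw [← contract_mul, q.as_sum, Finset.sum_mul, map_sum, LinearMap.sum_apply, map_sum]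
  exact Finset.sum_eq_zero fun β _ => key β _

end Contraction

/-! ### Differentiation as contraction of divided powers -/

section Differentiation

variable {k : Type*} [Field k] {σ : Type*} [Fintype σ]

theorem coeff_toDividedPowers (α : σ →₀ ℕ) (f : MvPolynomial σ k) :
    coeff α (toDividedPowers f) = ((∏ i, (α i).factorial : ℕ) : k) * coeff α f := by
  classical
  induction f using MvPolynomial.induction_on' with
  | add p q hp hq => rw [map_add, coeff_add, hp, hq, coeff_add, mul_add]
  | monomial β c =>
    have h2 : monomial β c = c • basisMonomials σ k β := by
      simp [coe_basisMonomials, smul_monomial]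
    rw [h2, map_smul, toDividedPowers, Module.Basis.constr_basis, ← h2, coeff_smul, coeff_monomial,
      coeff_monomial]
    split_ifs with h
    · rw [h, smul_eq_mul, mul_comm]
    · simp

theorem toDividedPowers_monomial (α : σ →₀ ℕ) (c : k) :
    toDividedPowers (monomial α c) = monomial α (((∏ i, (α i).factorial : ℕ) : k) * c) := by
  classical
  ext β
  rw [coeff_toDividedPowers, coeff_monomial, coeff_monomial]
  split_ifs with h
  · rw [h]
  · simp

open Classical in
theorem diffAction_monomial (β α : σ →₀ ℕ) (c e : k) :
    diffAction (monomial β c) (monomial α e) =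
      if β ≤ α then monomial (α - β) (((∏ i, (α i).descFactorial (β i) : ℕ) : k) * (c * e))
      else 0 := by
  have h1 : monomial β c = c • basisMonomials σ k β := by
    simp [coe_basisMonomials, smul_monomial]
  have h2 : monomial α e = e • basisMonomials σ k α := by
    simp [coe_basisMonomials, smul_monomial]
  rw [h1, h2, map_smul, map_smul, LinearMap.smul_apply, diffAction, Module.Basis.constr_basis,
    Module.Basis.constr_basis]
  split_ifs
  · simp only [smul_monomial, smul_eq_mul]
    congr 1
    ring
  · simp

/-- The factor α! / (α - β)! of differentiation is exactly the ratio of the two divided power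
normalizations. -/
theorem toDividedPowers_diffAction (g f : MvPolynomial σ k) :
    toDividedPowers (diffAction g f) = contract g (toDividedPowers f) := by
  classical
  induction g using MvPolynomial.induction_on' with
  | add p q hp hq => simp [hp, hq]
  | monomial β c =>
    induction f using MvPolynomial.induction_on' with
    | add p q hp hq => simp [hp, hq]
    | monomial α e =>
      rw [diffAction_monomial, toDividedPowers_monomial, contract_monomial]
      split_ifs with h
      · rw [toDividedPowers_monomial]
        congr 1
        have : (∏ i, ((α - β) i).factorial) * ∏ i, (α i).descFactorial (β i) =
            ∏ i, (α i).factorial := by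
          rw [← Finset.prod_mul_distrib]
          exact Finset.prod_congr rfl fun i _ => Nat.factorial_mul_descFactorial (h i)
        rw [← this]
        push_cast
        ring
      · exact map_zero _

theorem constantCoeff_toDividedPowers (f : MvPolynomial σ k) :
    constantCoeff (toDividedPowers f) = constantCoeff f := by
  simp [constantCoeff_eq, coeff_toDividedPowers]

theorem isHomogeneous_toDividedPowers {f : MvPolynomial σ k} {d : ℕ} (hf : f.IsHomogeneous d) :
    (toDividedPowers f).IsHomogeneous d := by
  intro α hα
  refine hf fun h => hα ?_
  rw [coeff_toDividedPowers, h, mul_zero]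

theorem diffAction_X (m : σ) (f : MvPolynomial σ k) : diffAction (X m) f = pderiv m f := by
  classical
  induction f using MvPolynomial.induction_on' with
  | add p q hp hq => simp [hp, hq]
  | monomial α e =>
    rw [X, diffAction_monomial, pderiv_monomial]
    split_ifs with h
    · congr 1
      rw [one_mul, mul_comm, Finset.prod_eq_single m]
      · simp
      · intro i _ hi
        simp [Ne.symm hi]
      · simp
    · have : α m = 0 := by
        by_contra h0
        exact h (Finsupp.single_le_iff.2 (Nat.one_le_iff_ne_zero.2 h0))
      simp [this]

variable [CharZero k]

/-- In characteristic zero no α! vanishes. Identities for differentiation can therefore be checked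
for contraction. -/
theorem toDividedPowers_injective :
    Function.Injective (toDividedPowers : MvPolynomial σ k →ₗ[k] MvPolynomial σ k) := by
  rw [← LinearMap.ker_eq_bot, LinearMap.ker_eq_bot']
  intro f hf
  ext α
  have h := coeff_toDividedPowers α f
  rw [hf, coeff_zero, zero_eq_mul] at h
  refine h.resolve_left ?_
  exact_mod_cast Finset.prod_ne_zero_iff.2 fun i _ => Nat.factorial_ne_zero _

theorem diffAction_mul (g h f : MvPolynomial σ k) :
    diffAction (g * h) f = diffAction g (diffAction h f) := by
  apply toDividedPowers_injective
  simp only [toDividedPowers_diffAction, contract_mul]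

theorem diffAction_C (c : k) (f : MvPolynomial σ k) : diffAction (C c) f = c • f := by
  apply toDividedPowers_injective
  have hc : C c = c • (1 : MvPolynomial σ k) := by rw [smul_eq_C_mul, mul_one]
  rw [toDividedPowers_diffAction, map_smul, hc, map_smul, LinearMap.smul_apply, contract_one]

end Differentiation

/-! ### Changes of coordinates and affine charts -/

section Coordinates

variable {k : Type*} [Field k] {n : ℕ}

theorem dehomogenize_monomial (α : Fin (n + 1) →₀ ℕ) (c : k) :
    dehomogenize (monomial α c) = monomial α.tail c := by
  rw [dehomogenize, aeval_monomial, Finsupp.prod_fintype _ _ (fun _ => pow_zero _),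
    Fin.prod_univ_succ, monomial_eq, Finsupp.prod_fintype _ _ (fun _ => pow_zero _)]
  simp [Finsupp.tail_apply, algebraMap_eq]

theorem degree_eq_add_degree_tail (α : Fin (n + 1) →₀ ℕ) : α.degree = α 0 + α.tail.degree := by
  rw [Finsupp.degree_eq_sum, Finsupp.degree_eq_sum, Fin.sum_univ_succ]
  rfl

/-- In a fixed degree the exponent of X_0 is determined by the others, so setting X_0 = 1 merges no
monomials. -/
theorem constantCoeff_contract_dehomogenize {d : ℕ} {g f : MvPolynomial (Fin (n + 1)) k}
    (hg : g.IsHomogeneous d) (hf : f.IsHomogeneous d) :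
    constantCoeff (contract (dehomogenize g) (dehomogenize f)) = constantCoeff (contract g f) := by
  classical
  rw [g.as_sum, f.as_sum]
  simp only [map_sum, LinearMap.sum_apply]
  refine Finset.sum_congr rfl fun β hβ => Finset.sum_congr rfl fun α hα => ?_
  rw [dehomogenize_monomial, dehomogenize_monomial, constantCoeff_eq, coeff_contract_monomial,
    constantCoeff_eq, coeff_contract_monomial, zero_add, zero_add, coeff_monomial, coeff_monomial]
  have h1 : α.degree = d := by
    by_contra h
    exact mem_support_iff.1 hα (hg.coeff_eq_zero h)
  have h2 : β.degree = d := by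
    by_contra h
    exact mem_support_iff.1 hβ (hf.coeff_eq_zero h)
  have h3 : β.tail = α.tail ↔ β = α := by
    refine ⟨fun h => ?_, fun h => by rw [h]⟩
    rw [← Finsupp.cons_tail β, ← Finsupp.cons_tail α, h]
    congr 1
    rw [degree_eq_add_degree_tail] at h1 h2
    rw [h] at h2
    omega
  simp only [h3]

theorem changeS_linear (b : LinearCoords k n) (p : homogeneousSubmodule (Fin (n + 1)) k 1) :
    changeS b (p : MvPolynomial (Fin (n + 1)) k) = ∑ j, b.repr p j • X j := by
  conv_lhs => rw [eq_sum_linX p]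
  conv_rhs => rw [eq_sum_linX p]
  simp only [Submodule.coe_sum, Submodule.coe_smul, map_sum, map_smul, linX, changeS, aeval_X,
    Finset.smul_sum, Finsupp.coe_finsetSum, Finset.sum_apply, Finsupp.smul_apply, smul_eq_mul,
    Finset.sum_smul, mul_smul]
  rw [Finset.sum_comm]

theorem changeS_basis (b : LinearCoords k n) (j : Fin (n + 1)) :
    changeS b (b j : MvPolynomial (Fin (n + 1)) k) = X j := by
  rw [changeS_linear]
  simp [Finsupp.single_apply]

theorem sum_repr_mul_coeff (b : LinearCoords k n) (l m : Fin (n + 1)) :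
    ∑ j, coeff (Finsupp.single m 1) (b j : MvPolynomial (Fin (n + 1)) k) * b.repr (linX l) j =
      if l = m then 1 else 0 := by
  classical
  have h := congrArg (fun p : homogeneousSubmodule (Fin (n + 1)) k 1 =>
    coeff (Finsupp.single m 1) (p : MvPolynomial (Fin (n + 1)) k)) (b.sum_repr (linX l))
  simp only [Submodule.coe_sum, Submodule.coe_smul, coeff_sum, coeff_smul, smul_eq_mul] at h
  simp only [mul_comm (coeff _ _)]
  rw [h]
  change coeff _ (X l) = _
  rw [coeff_X]
  simp [Finsupp.single_left_inj]

theorem exists_changeR_eq_X (b : LinearCoords k n) (j : Fin (n + 1)) :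
    ∃ T : MvPolynomial (Fin (n + 1)) k, T.IsHomogeneous 1 ∧ changeR b T = X j := by
  classical
  refine ⟨∑ m, b.repr (linX m) j • X m, ?_, ?_⟩
  · refine Submodule.sum_mem (homogeneousSubmodule (Fin (n + 1)) k 1) fun m _ => ?_
    exact Submodule.smul_mem _ _ (isHomogeneous_X k m)
  · have key : ∀ i, ∑ m, b.repr (linX m) j *
        coeff (Finsupp.single m 1) (b i : MvPolynomial (Fin (n + 1)) k) = if i = j then 1 else 0 := by
      intro i
      have h := congrArg (fun p => b.repr p j) (eq_sum_linX (b i))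
      simp only [Module.Basis.repr_self, map_sum, map_smul, Finsupp.coe_finsetSum,
        Finset.sum_apply, Finsupp.smul_apply, smul_eq_mul, Finsupp.single_apply] at h
      rw [h]
      exact Finset.sum_congr rfl fun m _ => mul_comm _ _
    simp only [changeR, map_sum, map_smul, aeval_X, Finset.smul_sum, smul_smul]
    rw [Finset.sum_comm]
    simp only [← Finset.sum_smul, key]
    simp

theorem isHomogeneous_changeR (b : LinearCoords k n) {g : MvPolynomial (Fin (n + 1)) k} {d : ℕ}
    (hg : g.IsHomogeneous d) : (changeR b g).IsHomogeneous d := by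
  rw [← one_mul d]
  refine hg.aeval _ fun m => ?_
  refine Submodule.sum_mem (homogeneousSubmodule (Fin (n + 1)) k 1) fun j _ => ?_
  exact Submodule.smul_mem _ _ (isHomogeneous_X k j)

theorem isHomogeneous_changeS (b : LinearCoords k n) {f : MvPolynomial (Fin (n + 1)) k} {d : ℕ}
    (hf : f.IsHomogeneous d) : (changeS b f).IsHomogeneous d := by
  rw [← one_mul d]
  refine hf.aeval _ fun m => ?_
  refine Submodule.sum_mem (homogeneousSubmodule (Fin (n + 1)) k 1) fun j _ => ?_
  exact Submodule.smul_mem _ _ (isHomogeneous_X k j)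

theorem constantCoeff_changeS (b : LinearCoords k n) (f : MvPolynomial (Fin (n + 1)) k) :
    constantCoeff (changeS b f) = constantCoeff f := by
  induction f using MvPolynomial.induction_on with
  | C a => simp [changeS, algebraMap_eq]
  | add p q hp hq => simp only [map_add, hp, hq]
  | mul_X p i _ => simp [changeS, constantCoeff_X]

/-- This is the chain rule, with ∂L_j/∂X_m as coefficients. -/
theorem changeS_pderiv (b : LinearCoords k n) (m : Fin (n + 1)) (f : MvPolynomial (Fin (n + 1)) k) :
    changeS b (pderiv m f) = ∑ j, coeff (Finsupp.single m 1)
      (b j : MvPolynomial (Fin (n + 1)) k) • pderiv j (changeS b f) := by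
  classical
  induction f using MvPolynomial.induction_on with
  | C a => simp [changeS, algebraMap_eq]
  | add p q hp hq => simp only [map_add, hp, hq, smul_add, Finset.sum_add_distrib]
  | mul_X p i hp =>
    have hX : ∀ j, pderiv j (changeS b (X i)) = C (b.repr (linX i) j) := by
      intro j
      simp [changeS, pderiv_X, Pi.single_apply, smul_eq_C_mul]
    have h2 : ∑ j, coeff (Finsupp.single m 1) (b j : MvPolynomial (Fin (n + 1)) k) •
        C (b.repr (linX i) j) =
        (C (if i = m then 1 else 0) : MvPolynomial (Fin (n + 1)) k) := by
      rw [← sum_repr_mul_coeff b i m, map_sum]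
      simp [smul_eq_C_mul]
    simp only [map_mul, Derivation.leibniz, map_add, smul_eq_mul, hp, pderiv_X, hX, smul_add,
      Finset.sum_add_distrib]
    simp only [← mul_smul_comm, ← Finset.mul_sum, h2]
    congr 2
    rw [Pi.single_apply]
    split_ifs <;> simp_all

/-- The origin of the chart is the point [L]: the constant term is the value of the linear form at L
= `b 0`. -/
theorem constantCoeff_chart_linear (b : LinearCoords k n) (t : Fin (n + 1) → k) :
    constantCoeff (chart b (∑ m, t m • X m)) =
      ∑ m, t m * coeff (Finsupp.single m 1) (b 0 : MvPolynomial (Fin (n + 1)) k) := by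
  simp only [chart, AlgHom.comp_apply, changeR, map_sum, map_smul, aeval_X, dehomogenize]
  refine Finset.sum_congr rfl fun m _ => ?_
  rw [Fin.sum_univ_succ]
  simp [smul_eq_C_mul]

/-- The part of degree at most `q` of any polynomial comes from a form of degree `q`. -/
theorem exists_isHomogeneous_contract_chart (b : LinearCoords k n) {q r : ℕ}
    {f : MvPolynomial (Fin n) k} (hf : f ∈ degreeLT k (Fin n) (q + 1 + r))
    (g : MvPolynomial (Fin n) k) :
    ∃ H : MvPolynomial (Fin (n + 1)) k, H.IsHomogeneous q ∧
      contract (chart b H) f - contract g f ∈ degreeLT k (Fin n) r := by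
  induction g using MvPolynomial.induction_on' with
  | add g₁ g₂ h₁ h₂ =>
    obtain ⟨H₁, hH₁, h₁⟩ := h₁
    obtain ⟨H₂, hH₂, h₂⟩ := h₂
    refine ⟨H₁ + H₂, hH₁.add hH₂, ?_⟩
    have := add_mem h₁ h₂
    rw [map_add, map_add, map_add, LinearMap.add_apply, LinearMap.add_apply]
    convert this using 1
    ring
  | monomial β c =>
    by_cases hβ : q + 1 ≤ β.degree
    -- Monomials of degree above q already push f below degree r. The others are homogenized by
    -- powers of `T 0`, which is 1 in the chart.
    · refine ⟨0, isHomogeneous_zero _ _ _, ?_⟩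
      rw [map_zero, map_zero, LinearMap.zero_apply, zero_sub]
      exact neg_mem (contract_monomial_mem_degreeLT hf hβ c)
    · choose T hT hTX using exists_changeR_eq_X b
      have hT0 : chart b (T 0) = 1 := by
        rw [chart, AlgHom.comp_apply, hTX]
        simp [dehomogenize]
      have hTs : ∀ j : Fin n, chart b (T j.succ) = X j := by
        intro j
        rw [chart, AlgHom.comp_apply, hTX]
        simp [dehomogenize]
      refine ⟨c • (T 0 ^ (q - β.degree) * ∏ j, T j.succ ^ β j), ?_, ?_⟩
      · refine Submodule.smul_mem (homogeneousSubmodule (Fin (n + 1)) k q) _ ?_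
        have h := ((hT 0).pow (q - β.degree)).mul
          (IsHomogeneous.prod Finset.univ (fun j : Fin n => T j.succ ^ β j) (fun j => 1 * β j)
            fun j _ => (hT j.succ).pow (β j))
        simp only [one_mul, ← Finsupp.degree_eq_sum] at h
        rwa [Nat.sub_add_cancel (by omega)] at h
      · have : chart b (c • (T 0 ^ (q - β.degree) * ∏ j, T j.succ ^ β j)) = monomial β c := by
          simp only [map_smul, map_mul, map_pow, hT0, one_pow, one_mul, map_prod, hTs]
          rw [monomial_eq, Finsupp.prod_fintype _ _ (fun _ => pow_zero _), smul_eq_C_mul]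
        rw [this, sub_self]
        exact zero_mem _

/-- The local generator of `L^a G` has degree at most `deg G`. -/
theorem localGenerator_mem_degreeLT (b : LinearCoords k n) {L G : MvPolynomial (Fin (n + 1)) k}
    (hL : (b 0 : MvPolynomial (Fin (n + 1)) k) = L) (a : ℕ) {m : ℕ} (hG : G.IsHomogeneous m) :
    localGenerator b (L ^ a * G) ∈ degreeLT k (Fin n) (m + 1) := by
  -- In these coordinates L is X_0, so only the degree of G in the remaining variables survives
  -- dehomogenization.
  rw [localGenerator, map_mul, map_pow, ← hL, changeS_basis]
  have hP := isHomogeneous_changeS b hG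
  rw [(changeS b G).as_sum, Finset.mul_sum, map_sum, map_sum]
  refine sum_mem fun γ hγ => ?_
  have hd : γ.degree = m := by
    by_contra h
    exact mem_support_iff.1 hγ (hP.coeff_eq_zero h)
  rw [X_pow_eq_monomial, monomial_mul, toDividedPowers_monomial, dehomogenize_monomial]
  refine monomial_mem_degreeLT ?_ _
  rw [degree_eq_add_degree_tail] at hd
  have : (Finsupp.single 0 a + γ).tail = γ.tail := by
    ext i
    simp [Finsupp.tail_apply]
  rw [this]
  omega

variable [CharZero k]

theorem changeS_diffAction (b : LinearCoords k n) (g f : MvPolynomial (Fin (n + 1)) k) :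
    changeS b (diffAction g f) = diffAction (changeR b g) (changeS b f) := by
  induction g using MvPolynomial.induction_on generalizing f with
  | C a => simp [diffAction_C, changeR, algebraMap_eq]
  | add p q hp hq => simp only [map_add, LinearMap.add_apply, hp, hq]
  | mul_X p m hp =>
    rw [diffAction_mul, hp, map_mul, diffAction_mul, diffAction_X, changeS_pderiv]
    congr 1
    simp only [changeR, aeval_X, map_sum, map_smul, LinearMap.sum_apply, LinearMap.smul_apply,
      diffAction_X]

/-- The apolarity pairing of forms of the same degree, computed in an affine chart. -/
theorem constantCoeff_contract_chart (b : LinearCoords k n) {d : ℕ}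
    {g f : MvPolynomial (Fin (n + 1)) k} (hg : g.IsHomogeneous d) (hf : f.IsHomogeneous d) :
    constantCoeff (contract (chart b g) (localGenerator b f)) =
      constantCoeff (contract g (toDividedPowers f)) := by
  rw [← toDividedPowers_diffAction, constantCoeff_toDividedPowers, ← constantCoeff_changeS b,
    changeS_diffAction, ← constantCoeff_toDividedPowers (diffAction _ _), toDividedPowers_diffAction, chart,
    AlgHom.comp_apply, localGenerator]
  exact constantCoeff_contract_dehomogenize (isHomogeneous_changeR b hg)
    (isHomogeneous_toDividedPowers (isHomogeneous_changeS b hf))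

/-- Through this, a perturbed local generator again defines a `naturalApolar` scheme, with
saturation and dimension for free; F need not be homogeneous. -/
theorem exists_localGenerator_eq (b : LinearCoords k n) (p : MvPolynomial (Fin n) k) :
    ∃ F : MvPolynomial (Fin (n + 1)) k, localGenerator b F = p := by
  have hS : ∀ q, changeS b (aeval (fun j => (b j : MvPolynomial (Fin (n + 1)) k)) q) = q := by
    intro q
    rw [← AlgHom.comp_apply]
    conv_rhs => rw [← AlgHom.id_apply (R := k) q]
    congr 1
    ext j : 1
    simp [changeS_basis]
  obtain ⟨P, hP⟩ : ∃ P, toDividedPowers P = rename Fin.succ p := by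
    refine ⟨∑ α ∈ (rename Fin.succ p).support, monomial α
      (((∏ i, (α i).factorial : ℕ) : k)⁻¹ * coeff α (rename Fin.succ p)), ?_⟩
    conv_rhs => rw [(rename Fin.succ p).as_sum]
    rw [map_sum]
    refine Finset.sum_congr rfl fun α _ => ?_
    rw [toDividedPowers_monomial, mul_inv_cancel_left₀]
    exact_mod_cast Finset.prod_ne_zero_iff.2 fun i _ => Nat.factorial_ne_zero _
  refine ⟨aeval (fun j => (b j : MvPolynomial (Fin (n + 1)) k)) P, ?_⟩
  rw [localGenerator, hS, hP, dehomogenize, aeval_rename]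
  have : (Fin.cons 1 X : Fin (n + 1) → MvPolynomial (Fin n) k) ∘ Fin.succ = X := by
    ext1 j
    simp
  rw [this, aeval_X_left_apply]

end Coordinates

/-! ### Surjectivity of evaluation and regularity -/

section Evaluation

variable {k : Type*} [Field k] {n s : ℕ}

instance (f : MvPolynomial (Fin n) k) : Module.Finite k (LinearMap.range (contract.flip f)) :=
  finite_range_contract f

/-- Linear forms in the dual variables that are dual to linearly independent linear forms. -/
theorem exists_dual_linear (b : Fin s → LinearCoords k n)
    (hb : LinearIndependent k fun i => (b i 0 : MvPolynomial (Fin (n + 1)) k)) :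
    ∃ T : Fin s → MvPolynomial (Fin (n + 1)) k, (∀ i, (T i).IsHomogeneous 1) ∧
      ∀ i j, constantCoeff (chart (b j) (T i)) = if i = j then 1 else 0 := by
  classical
  let c : homogeneousSubmodule (Fin (n + 1)) k 1 →ₗ[k] (Fin (n + 1) → k) :=
    (LinearMap.pi fun m => lcoeff k (Finsupp.single m 1)) ∘ₗ
      (homogeneousSubmodule (Fin (n + 1)) k 1).subtype
  have hc : LinearMap.ker c = ⊥ := by
    rw [LinearMap.ker_eq_bot']
    intro p hp
    rw [eq_sum_linX p]
    refine Finset.sum_eq_zero fun m _ => ?_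
    have : coeff (Finsupp.single m 1) (p : MvPolynomial (Fin (n + 1)) k) = 0 := congrFun hp m
    rw [this, zero_smul]
  have hv : LinearIndependent k fun i => c (b i 0) :=
    (LinearIndependent.of_comp (homogeneousSubmodule (Fin (n + 1)) k 1).subtype hb).map' c hc
  have hφ : ∀ i, ∃ φ : (Fin (n + 1) → k) →ₗ[k] k, ∀ j, φ (c (b j 0)) = if i = j then 1 else 0 := by
    intro i
    -- The i-th coordinate on the span of the L_j, extended to all of S_1, is the form T_i.
    obtain ⟨φ, hφ⟩ := LinearMap.exists_extend (Finsupp.lapply i ∘ₗ hv.repr)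
    refine ⟨φ, fun j => ?_⟩
    have h := LinearMap.congr_fun hφ ⟨c (b j 0), Submodule.subset_span ⟨j, rfl⟩⟩
    simp only [LinearMap.comp_apply, Submodule.subtype_apply] at h
    rw [h, hv.repr_eq_single j _ rfl, Finsupp.lapply_apply,
      Finsupp.single_apply]
    simp only [eq_comm]
  choose φ hφ using hφ
  refine ⟨fun i => ∑ m, φ i (Pi.single m 1) • X m, fun i => ?_, fun i j => ?_⟩
  · refine Submodule.sum_mem (homogeneousSubmodule (Fin (n + 1)) k 1) fun m _ => ?_
    exact Submodule.smul_mem _ _ (isHomogeneous_X k m)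
  · rw [constantCoeff_chart_linear, ← hφ i j, LinearMap.pi_apply_eq_sum_univ (φ i)]
    refine Finset.sum_congr rfl fun m _ => ?_
    rw [mul_comm, smul_eq_mul]
    congr 2
    ext l
    simp [Pi.single_apply, eq_comm]

/-- Forms of degree `e` realize arbitrary tuples of local values up to terms of degree less than
`r`, when `f_i` has degree less than `q_i + r` and the `q_i` are small with respect to `e`. -/
theorem exists_isHomogeneous_approx (hs : 1 < s) (b : Fin s → LinearCoords k n)
    (hb : LinearIndependent k fun i => (b i 0 : MvPolynomial (Fin (n + 1)) k))
    {f : Fin s → MvPolynomial (Fin n) k} {q : Fin s → ℕ} {r e : ℕ}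
    (hf : ∀ i, f i ∈ degreeLT k (Fin n) (q i + r)) (he : ∀ i j, i ≠ j → q i + q j ≤ e + 1)
    (g : Fin s → MvPolynomial (Fin n) k) :
    ∃ G : MvPolynomial (Fin (n + 1)) k, G.IsHomogeneous e ∧
      ∀ i, contract (chart (b i) G) (f i) - contract (g i) (f i) ∈ degreeLT k (Fin n) r := by
  classical
  obtain ⟨T, hT, hTc⟩ := exists_dual_linear b hb
  have key : ∀ i, ∃ G : MvPolynomial (Fin (n + 1)) k, G.IsHomogeneous e ∧
      (contract (chart (b i) G) (f i) - contract (g i) (f i) ∈ degreeLT k (Fin n) r) ∧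
      ∀ j, j ≠ i → contract (chart (b j) G) (f j) ∈ degreeLT k (Fin n) r := by
    intro i
    rcases hqi : q i with _ | p
    -- Here f_i itself has degree less than r.
    · refine ⟨0, isHomogeneous_zero _ _ _, ?_, fun j _ => by simp⟩
      have h := hf i
      rw [hqi, zero_add] at h
      simpa using contract_mem_degreeLT (g i) h
    -- A second index exists because s > 1; without it nothing would bound q_i by e + 1.
    · have hpe : p ≤ e := by
        have : Nontrivial (Fin s) := Fin.nontrivial_iff_two_le.2 hs
        obtain ⟨j, hj⟩ := exists_ne i
        have := he i j hj.symm
        omega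
      have hii : constantCoeff (chart (b i) (T i)) = 1 := by rw [hTc, if_pos rfl]
      -- T_i is a unit at L_i, so T_i^(e-p) can be divided out of g_i; a form H of degree p = q_i -
      -- 1 then approximates the quotient v.
      obtain ⟨v, hv⟩ := exists_contract_pow_mul_eq hii (f i) (e - p) (g i)
      have hfi := hf i
      rw [hqi] at hfi
      obtain ⟨H, hH, hHv⟩ := exists_isHomogeneous_contract_chart (b i) hfi v
      refine ⟨T i ^ (e - p) * H, ?_, ?_, fun j hj => ?_⟩
      · have := ((hT i).pow (e - p)).mul hH
        rwa [one_mul, Nat.sub_add_cancel hpe] at this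
      · rw [← hv, map_mul, map_pow, contract_mul, contract_mul, ← map_sub]
        exact contract_mem_degreeLT _ hHv
      -- T_i vanishes at L_j, so its power lowers the degree of f_j by e - p, and q_i + q_j ≤ e + 1
      -- says q_j ≤ e - p.
      · rw [mul_comm, map_mul, map_pow, contract_mul]
        refine contract_mem_degreeLT _ (contract_pow_mem_degreeLT ?_ _ ?_)
        · rw [hTc, if_neg hj.symm]
        · refine degreeLT_mono ?_ (hf j)
          have := he i j hj.symm
          omega
  choose G hG hGi hGj using key
  refine ⟨∑ i, G i, IsHomogeneous.sum _ _ _ fun i _ => hG i, fun i => ?_⟩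
  rw [map_sum, map_sum, LinearMap.sum_apply, ← Finset.add_sum_erase _ _ (Finset.mem_univ i),
    add_sub_right_comm]
  exact add_mem (hGi i) (sum_mem fun j hj => hGj j i (Finset.ne_of_mem_erase hj).symm)

/-- The map `R_e → ∏ k[y] ⌟ f_i`, whose kernel is the degree `e` part of the intersection of the
homogenizations of the annihilators of the `f_i`. -/
noncomputable def evaluation (b : Fin s → LinearCoords k n) (f : Fin s → MvPolynomial (Fin n) k) (e : ℕ) :
    homogeneousSubmodule (Fin (n + 1)) k e →ₗ[k]
      ((i : Fin s) → LinearMap.range (contract.flip (f i))) :=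
  LinearMap.pi fun i => (contract.flip (f i)).rangeRestrict ∘ₗ (chart (b i)).toLinearMap ∘ₗ
    (homogeneousSubmodule (Fin (n + 1)) k e).subtype

theorem coe_evaluation (b : Fin s → LinearCoords k n) (f : Fin s → MvPolynomial (Fin n) k) {e : ℕ}
    (x : homogeneousSubmodule (Fin (n + 1)) k e) (i : Fin s) :
    (evaluation b f e x i : MvPolynomial (Fin n) k) =
      contract (chart (b i) (x : MvPolynomial (Fin (n + 1)) k)) (f i) := rfl

theorem hilbertFunction_eq_of_surjective {b : Fin s → LinearCoords k n}
    {f : Fin s → MvPolynomial (Fin n) k} {e : ℕ} (h : Function.Surjective (evaluation b f e)) :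
    hilbertFunction (⨅ i, homogenizeIdeal (b i) (contractAnn (f i))) e =
      Module.finrank k ((i : Fin s) → LinearMap.range (contract.flip (f i))) := by
  have hker : LinearMap.ker (evaluation b f e) =
      gradedPiece (⨅ i, homogenizeIdeal (b i) (contractAnn (f i))) e := by
    ext x
    rw [LinearMap.mem_ker, funext_iff]
    simp only [gradedPiece, Submodule.mem_comap, Submodule.restrictScalars_mem, Submodule.mem_iInf,
      Submodule.subtype_apply]
    refine forall_congr' fun i => ?_
    rw [mem_homogenizeIdeal_of_isHomogeneous (b i) _ x.2, mem_contractAnn, ← coe_evaluation,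
      Pi.zero_apply, Submodule.coe_eq_zero]
  rw [hilbertFunction, ← hker]
  exact (LinearMap.quotKerEquivOfSurjective _ h).finrank_eq

/-- The linear form ∑ T_j takes the value 1 at every L_i, so multiplication by it is invertible on
each k[y] ⌟ f_i. -/
theorem surjective_evaluation_succ {b : Fin s → LinearCoords k n}
    (hb : LinearIndependent k fun i => (b i 0 : MvPolynomial (Fin (n + 1)) k))
    {f : Fin s → MvPolynomial (Fin n) k} {e : ℕ} (h : Function.Surjective (evaluation b f e)) :
    Function.Surjective (evaluation b f (e + 1)) := by
  classical
  obtain ⟨T, hT, hTc⟩ := exists_dual_linear b hb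
  have hc : ∀ i, constantCoeff (chart (b i) (∑ j, T j)) = 1 := by
    intro i
    simp [hTc]
  choose v hv using fun i => exists_contract_mul_eq (hc i) (f i)
  intro w
  choose g hg using fun i => LinearMap.mem_range.1 (w i).2
  obtain ⟨x, hx⟩ := h fun i => ⟨contract (v i * g i) (f i), ⟨v i * g i, rfl⟩⟩
  refine ⟨⟨(∑ j, T j) * x, ?_⟩, ?_⟩
  · have := (IsHomogeneous.sum Finset.univ T 1 fun i _ => hT i).mul x.2
    rwa [add_comm 1 e] at this
  · funext i
    apply Subtype.ext
    have hxi := congrArg Subtype.val (congrFun hx i)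
    rw [coe_evaluation] at hxi
    rw [coe_evaluation, map_mul, contract_mul, hxi, ← contract_mul, ← mul_assoc, hv]
    exact hg i

theorem isRegular_of_surjective {b : Fin s → LinearCoords k n}
    (hb : LinearIndependent k fun i => (b i 0 : MvPolynomial (Fin (n + 1)) k))
    {f : Fin s → MvPolynomial (Fin n) k} {d : ℕ} (h : Function.Surjective (evaluation b f d))
    {Z : ZeroDimScheme k n} (hZ : Z.ideal = ⨅ i, homogenizeIdeal (b i) (contractAnn (f i))) :
    Z.IsRegular d := by
  have hsurj : ∀ e, d ≤ e → Function.Surjective (evaluation b f e) := fun e he =>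
    Nat.le_induction h (fun _ _ => surjective_evaluation_succ hb) e he
  have hHF : ∀ e, d ≤ e → hilbertFunction Z.ideal e =
      Module.finrank k ((i : Fin s) → LinearMap.range (contract.flip (f i))) := by
    intro e he
    rw [hZ]
    exact hilbertFunction_eq_of_surjective (hsurj e he)
  have hlen : ∀ e, d ≤ e → Z.HasLength (hilbertFunction Z.ideal e) := by
    intro e he
    filter_upwards [Filter.eventually_ge_atTop d] with i hi
    rw [hHF i hi, hHF e he]
  exact sInf_le ⟨d, ⟨hlen d le_rfl, hlen (d + 1) (Nat.le_succ d)⟩, rfl⟩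

/-- Case (a): with r = 0 the approximation is exact, and q_i = m_i + 1 turns its condition into m_i
+ m_j < e. -/
theorem surjective_evaluation_of_degree_lt (hs : 1 < s) {b : Fin s → LinearCoords k n}
    (hb : LinearIndependent k fun i => (b i 0 : MvPolynomial (Fin (n + 1)) k))
    {f : Fin s → MvPolynomial (Fin n) k} {m : Fin s → ℕ} {e : ℕ}
    (hf : ∀ i, f i ∈ degreeLT k (Fin n) (m i + 1)) (he : ∀ i j, i ≠ j → m i + m j < e) :
    Function.Surjective (evaluation b f e) := by
  intro w
  choose g hg using fun i => LinearMap.mem_range.1 (w i).2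
  obtain ⟨G, hG, hGw⟩ := exists_isHomogeneous_approx (q := fun i => m i + 1) (r := 0) hs b hb hf
    (fun i j hij => by have := he i j hij; omega : ∀ i j, i ≠ j → m i + 1 + (m j + 1) ≤ e + 1) g
  refine ⟨⟨G, hG⟩, funext fun i => Subtype.ext ?_⟩
  rw [coe_evaluation, ← hg i]
  exact sub_eq_zero.1 (eq_zero_of_mem_degreeLT_zero (hGw i))

end Evaluation

/-! ### Shrinking an apolar scheme when evaluation is not onto -/

section Irredundant

variable {k : Type*} [Field k] [CharZero k] {n s : ℕ}

/-- A homogeneous ideal is contained in `Ann(F)` as soon as its part of degree `deg F` is. -/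
theorem isApolar_of_degree_eq {F : MvPolynomial (Fin (n + 1)) k} {d : ℕ} (hF : F.IsHomogeneous d)
    {Z : ZeroDimScheme k n}
    (h : ∀ G ∈ Z.ideal, G.IsHomogeneous d →
      constantCoeff (contract G (toDividedPowers F)) = 0) : Z.IsApolar F := by
  classical
  intro G hG
  change diffAction G F = 0
  apply toDividedPowers_injective
  rw [toDividedPowers_diffAction, map_zero,
    ← DirectSum.sum_support_decompose (homogeneousSubmodule (Fin (n + 1)) k) G, map_sum,
    LinearMap.sum_apply]
  refine Finset.sum_eq_zero fun e _ => ?_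
  have hGe : (DirectSum.decompose (homogeneousSubmodule (Fin (n + 1)) k) G e :
      MvPolynomial (Fin (n + 1)) k).IsHomogeneous e :=
    (DirectSum.decompose (homogeneousSubmodule (Fin (n + 1)) k) G e).2
  -- Multiples of degree d of each component of G stay in the ideal, where `h` applies.
  refine contract_eq_zero_of_multiples hGe (isHomogeneous_toDividedPowers hF) ?_
  intro q p hp hq
  refine h _ (Z.ideal.mul_mem_left q ((Z.homogeneous.mem_iff _).1 hG e)) ?_
  rw [← hp]
  exact hq.mul hGe

/-- Replacing the local generators `f_i` by `f_i - c u_i ⌟ f_i`, where the functional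
`(w_i) ↦ ∑ (u_i ⌟ w_i)(0)` vanishes on the image of `R_d`, gives another apolar scheme, and a
strictly smaller one if `c u_i(0) = 1` for some `i` with `f_i ≠ 0`. -/
theorem exists_strictSubscheme_isApolar (hs : 1 < s) {b : Fin s → LinearCoords k n}
    (hb : LinearIndependent k fun i => (b i 0 : MvPolynomial (Fin (n + 1)) k))
    {P : Fin s → MvPolynomial (Fin (n + 1)) k} {d : ℕ} (hP : ∀ i, (P i).IsHomogeneous d)
    {Z : ZeroDimScheme k n}
    (hZ : Z.ideal = ⨅ i, homogenizeIdeal (b i) (contractAnn (localGenerator (b i) (P i))))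
    {u : Fin s → MvPolynomial (Fin n) k}
    (hu : ∀ G : MvPolynomial (Fin (n + 1)) k, G.IsHomogeneous d →
      ∑ i, constantCoeff (contract (u i) (contract (chart (b i) G) (localGenerator (b i) (P i)))) = 0)
    {i₀ : Fin s} (hu₀ : constantCoeff (u i₀) ≠ 0) {g₀ : MvPolynomial (Fin n) k}
    (hg₀ : contract g₀ (localGenerator (b i₀) (P i₀)) = 1) :
    ∃ Z' : ZeroDimScheme k n, Z'.IsStrictSubscheme Z ∧ Z'.IsApolar (∑ i, P i) := by
  classical
  set f : Fin s → MvPolynomial (Fin n) k := fun i => localGenerator (b i) (P i) with hf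
  -- With this scaling 1 - c u_{i₀} has no constant term, so it kills constants.
  set c : k := (constantCoeff (u i₀))⁻¹ with hc
  choose P' hP' using fun i => exists_localGenerator_eq (b i) (contract (1 - c • u i) (f i))
  have hcomm : ∀ i g, contract g (contract (1 - c • u i) (f i)) =
      contract (1 - c • u i) (contract g (f i)) := by
    intro i g
    rw [← contract_mul, mul_comm, contract_mul]
  obtain ⟨Z', hZ'⟩ : ∃ Z' : ZeroDimScheme k n,
      Z'.ideal = ⨅ i, homogenizeIdeal (b i) (contractAnn (contract (1 - c • u i) (f i))) :=
    ⟨ZeroDimScheme.union fun i => naturalApolar (b i) (P' i),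
      iInf_congr fun i => by rw [← hP']; rfl⟩
  have hmem : ∀ {G : MvPolynomial (Fin (n + 1)) k} {e : ℕ}, G.IsHomogeneous e →
      (G ∈ Z'.ideal ↔
        ∀ i, contract (1 - c • u i) (contract (chart (b i) G) (f i)) = 0) := by
    intro G e hG
    rw [hZ']
    refine Ideal.mem_iInf.trans (forall_congr' fun i => ?_)
    rw [← hcomm]
    exact mem_homogenizeIdeal_of_isHomogeneous (b i) _ hG
  have hmemZ : ∀ {G : MvPolynomial (Fin (n + 1)) k} {e : ℕ}, G.IsHomogeneous e →
      (G ∈ Z.ideal ↔ ∀ i, contract (chart (b i) G) (f i) = 0) := by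
    intro G e hG
    rw [hZ]
    refine Ideal.mem_iInf.trans (forall_congr' fun i => ?_)
    exact mem_homogenizeIdeal_of_isHomogeneous (b i) _ hG
  refine ⟨Z', ?_, ?_⟩
  · refine lt_of_le_of_ne (fun G hG => ?_) fun heq => ?_
    · change G ∈ Z'.ideal
      refine (Z'.homogeneous.mem_iff _).2 fun e => ?_
      have hGe : (DirectSum.decompose (homogeneousSubmodule (Fin (n + 1)) k) G e :
          MvPolynomial (Fin (n + 1)) k).IsHomogeneous e :=
        (DirectSum.decompose (homogeneousSubmodule (Fin (n + 1)) k) G e).2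
      refine (hmem hGe).2 fun i => ?_
      rw [(hmemZ hGe).1 ((Z.homogeneous.mem_iff _).1 hG e) i, map_zero]
    -- Strictness: in the large degree ∑ m_i some form has local value 1 at i₀ and 0 elsewhere. It
    -- lies in the ideal of Z' but not in that of Z.
    · choose m hm using fun i => exists_mem_degreeLT (f i)
      let γ : Fin s → MvPolynomial (Fin n) k := Function.update 0 i₀ g₀
      have hγ₀ : γ i₀ = g₀ := Function.update_self _ _ _
      have hγ : ∀ i, i ≠ i₀ → γ i = 0 := fun i hi => Function.update_of_ne hi _ _
      obtain ⟨G, hG, hGw⟩ := exists_isHomogeneous_approx (r := 0) (e := ∑ i, m i) hs b hb hm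
        (fun i j hij => by
          have := Finset.sum_le_sum_of_subset (f := m) (Finset.subset_univ {i, j})
          rw [Finset.sum_pair hij] at this
          omega) γ
      have hGv : ∀ i, contract (chart (b i) G) (f i) = contract (γ i) (f i) :=
        fun i => sub_eq_zero.1 (eq_zero_of_mem_degreeLT_zero (hGw i))
      have h1 : contract (chart (b i₀) G) (f i₀) = 1 := by
        rw [hGv, hγ₀]
        exact hg₀
      have hG' : G ∈ Z.ideal := by
        rw [heq]
        refine (hmem hG).2 fun i => ?_
        by_cases hi : i = i₀
        · subst hi
          rw [h1, ← C_1, contract_C]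
          simp [hc, hu₀, smul_eq_C_mul]
        · rw [hGv, hγ i hi]
          simp
      have h0 := (hmemZ hG).1 hG' i₀
      rw [h1] at h0
      exact one_ne_zero h0
  · refine isApolar_of_degree_eq (IsHomogeneous.sum _ _ _ fun i _ => hP i) fun G hG hGd => ?_
    have hG' := (hmem hGd).1 hG
    rw [map_sum, map_sum, map_sum]
    -- Membership in the ideal of Z' gives G ⌟ f_i = c u_i ⌟ (G ⌟ f_i), so the pairing with F is c
    -- times the sum in `hu`.
    have hGi : ∀ i, constantCoeff (contract G (toDividedPowers (P i))) =
        c * constantCoeff (contract (u i) (contract (chart (b i) G) (f i))) := by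
      intro i
      have h := hG' i
      rw [map_sub, map_smul, LinearMap.sub_apply, LinearMap.smul_apply, contract_one,
        sub_eq_zero] at h
      rw [← constantCoeff_contract_chart (b i) hGd (hP i), ← constantCoeff_C (σ := Fin n) c,
        ← map_mul, ← smul_eq_C_mul]
      simpa using congrArg constantCoeff h
    rw [Finset.sum_congr rfl fun i _ => hGi i, ← Finset.mul_sum, hu G hGd, mul_zero]

/-- Case (b): a functional vanishing on a proper image would yield a strictly smaller apolar scheme.
-/
theorem surjective_evaluation_of_irredundant (hs : 1 < s) {b : Fin s → LinearCoords k n}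
    (hb : LinearIndependent k fun i => (b i 0 : MvPolynomial (Fin (n + 1)) k))
    {P : Fin s → MvPolynomial (Fin (n + 1)) k} {d : ℕ} (hP : ∀ i, (P i).IsHomogeneous d)
    {Z : ZeroDimScheme k n}
    (hZ : Z.ideal = ⨅ i, homogenizeIdeal (b i) (contractAnn (localGenerator (b i) (P i))))
    {m : Fin s → ℕ} (hm : ∀ i, localGenerator (b i) (P i) ∈ degreeLT k (Fin n) (m i + 1))
    (hd : ∀ i j, i ≠ j → m i + m j ≤ d + 1) (hirr : Z.IsIrredundant (∑ i, P i)) :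
    Function.Surjective (evaluation b (fun i => localGenerator (b i) (P i)) d) := by
  classical
  rw [← LinearMap.range_eq_top]
  by_contra hV
  obtain ⟨lam, hlam, hle⟩ := Submodule.exists_le_ker_of_lt_top _ (lt_top_iff_ne_top.2 hV)
  choose u hu using fun i => exists_functional_eq _
    (lam ∘ₗ LinearMap.single k
      (fun i => LinearMap.range (contract.flip (localGenerator (b i) (P i)))) i)
  have hsum : ∀ w, lam w = ∑ i, constantCoeff (contract (u i) (w i : MvPolynomial (Fin n) k)) := by
    intro w
    rw [← Finset.univ_sum_single w, map_sum]
    refine Finset.sum_congr rfl fun i _ => ?_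
    rw [Finset.univ_sum_single, ← hu]
    rfl
  obtain ⟨w, hw⟩ : ∃ w, lam w ≠ 0 := by
    by_contra! h
    exact hlam (LinearMap.ext h)
  choose g hg using fun i => LinearMap.mem_range.1 (w i).2
  -- Taking r = 1 and q_i = m_i gains 2 in the degree condition; the remaining error w' is a tuple
  -- of constants.
  obtain ⟨G, hG, hGw⟩ := exists_isHomogeneous_approx (r := 1) hs b hb hm hd g
  set x : homogeneousSubmodule (Fin (n + 1)) k d := ⟨G, hG⟩
  set w' := w - evaluation b (fun i => localGenerator (b i) (P i)) d x
  have hw' : lam w' ≠ 0 := by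
    have : lam (evaluation b (fun i => localGenerator (b i) (P i)) d x) = 0 :=
      LinearMap.mem_ker.1 (hle ⟨x, rfl⟩)
    rwa [map_sub, this, sub_zero]
  rw [hsum] at hw'
  obtain ⟨i₀, -, hi₀⟩ := Finset.exists_ne_zero_of_sum_ne_zero hw'
  have hC : (w' i₀ : MvPolynomial (Fin n) k) =
      C (constantCoeff (w' i₀ : MvPolynomial (Fin n) k)) := by
    refine eq_C_of_mem_degreeLT_one ?_
    rw [← neg_mem_iff]
    convert hGw i₀ using 1
    have hgi : contract (g i₀) (localGenerator (b i₀) (P i₀)) = w i₀ := hg i₀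
    rw [hgi]
    change -((w i₀ : MvPolynomial (Fin n) k) - _) = _
    rw [neg_sub]
    rfl
  obtain ⟨h₀, hh₀⟩ := LinearMap.mem_range.1 (w' i₀).2
  rw [LinearMap.flip_apply] at hh₀
  -- The nonzero term is u_{i₀}(0) times the constant w'_{i₀}. Both factors are nonzero, and the
  -- second, after scaling, puts 1 in k[y] ⌟ f_{i₀}.
  rw [hC, contract_C, constantCoeff_C] at hi₀
  refine hirr.2 (exists_strictSubscheme_isApolar hs hb hP hZ (u := u) (fun G hG => ?_)
    (left_ne_zero_of_mul hi₀)
    (g₀ := (constantCoeff (w' i₀ : MvPolynomial (Fin n) k))⁻¹ • h₀) ?_)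
  · have := LinearMap.mem_ker.1 (hle ⟨⟨G, hG⟩, rfl⟩)
    rw [hsum] at this
    exact this
  · rw [map_smul, LinearMap.smul_apply, hh₀, hC, constantCoeff_C, smul_eq_C_mul, ← C_mul,
      inv_mul_cancel₀ (right_ne_zero_of_mul hi₀), C_1]

end Irredundant

end Apolarity

/-! ### The proposition -/

theorem mainTheorem4 {k : Type*} [Field k] [IsAlgClosed k] [CharZero k] {n d s : ℕ} (hs : 1 < s)
    (F : MvPolynomial (Fin (n + 1)) k) (hF : F.IsHomogeneous d)
    (D : Apolarity.GAD F d s) (hL : LinearIndependent k D.L)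
    (Z : Apolarity.ZeroDimScheme k n) (hZ : D.Evinces Z)
    (h : (∀ i j : Fin s, i ≠ j → (D.deg i : ℤ) + D.deg j < d) ∨
      ((∀ i j : Fin s, i ≠ j → (D.deg i : ℤ) + D.deg j - 2 < d) ∧ Z.IsIrredundant F)) :
    Z.IsRegular d := by
  obtain ⟨W, hW, rfl⟩ := hZ
  choose b hbL hWb using hW
  have hb : LinearIndependent k fun i => (b i 0 : MvPolynomial (Fin (n + 1)) k) := by
    simpa only [hbL] using hL
  have hideal : (Apolarity.ZeroDimScheme.union W).ideal = ⨅ i, Apolarity.homogenizeIdeal (b i)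
      (Apolarity.contractAnn (Apolarity.localGenerator (b i)
        (D.L i ^ (d - D.deg i) * D.G i))) :=
    iInf_congr fun i => congrArg Apolarity.ZeroDimScheme.ideal (hWb i)
  have hdeg := fun i => Apolarity.localGenerator_mem_degreeLT (b i) (hbL i) (d - D.deg i)
    (D.G_isHomogeneous i)
  refine Apolarity.isRegular_of_surjective hb ?_ hideal
  rcases h with h | ⟨h, hirr⟩
  · exact Apolarity.surjective_evaluation_of_degree_lt hs hb hdeg
      fun i j hij => by exact_mod_cast h i j hij
  · refine Apolarity.surjective_evaluation_of_irredundant hs hb (fun i => ?_) hideal hdeg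
      (fun i j hij => by have := h i j hij; omega) (by rwa [← D.eq_sum])
    have := ((D.L_isHomogeneous i).pow (d - D.deg i)).mul (D.G_isHomogeneous i)
    rwa [one_mul, Nat.sub_add_cancel (D.deg_le i)] at this
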